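/- Let $\mathfrak K$ be a field, $\Gamma$ a finite quiver, and $\Lambda=\mathfrak K\Gamma/I$ the quotient of its path algebra by an admissible ideal $I$ (so that $\Lambda$ is finite-dimensional), with Jacobson radical $J$. Paths are composed from right to left, and paths are identified with their classes in $\Lambda$; $\mathrm s(p)$ denotes the starting point of a path $p$, and also the corresponding idempotent. Modules are finitely generated left $\Lambda$-modules. A module is uniserial if it has exactly one composition series; a mast of a uniserial module $U$ of length $n$ is a path $p$ of length $n-1$ such that $px\neq 0$ for some $x\in U$. A path $u$ is a right subpath of a path $p$ if $p=ru$ for some path $r$. A detour on $p$ is a pair $(\alpha,u)$ of an arrow $\alpha$ and a right subpath $u$ of $p$ such that $\alpha u$ is a path which is not a right subpath of $p$, but some right subpath $v$ of $p$ with $\operatorname{length}(v)\ge\operatorname{length}(u)+1$ has the same end point as $\alpha$. If $p$ passes consecutively through the vertices $e(1),\dots,e(l+1)$, then a route on $p$ is a path starting in $e(1)$ whose sequence of vertices is a subsequence of $(e(1),\dots,e(l+1))$; a non-route on $p$ is a path starting in $e(1)$ which is not a route on $p$. A detour $(\alpha,u)$ on $p$ is inessential if in $\Lambda$ $$\alpha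 u = s+\sum_i k_i v_i,$$ where $s$ is a $\mathfrak K$-linear combination of paths none of which is a route on $p$, the $v_i$ are the right subpaths of $p$ which are longer than $u$ and have the same end point as $\alpha$, and $k_i\in\mathfrak K$. Theorem. Let $U$ be a non-simple uniserial $\Lambda$-module with mast $p$, where $p$ does not start with an oriented cycle (that is, no right subpath of $p$ of positive length ends in $\mathrm s(p)$). Suppose that the embedding $JU\hookrightarrow U$ is irreducible, that is, it is neither a split monomorphism nor a split epimorphism, and whenever it is a composition $h\circ g$ of homomorphisms of finitely generated modules, $g$ is a split monomorphism or $h$ is a split epimorphism. Then: (i) all detours on $p$ are inessential; (ii) all non-routes on $p$ lie in $Jp$. In particular, $U\cong\Lambda e/Jp$ with $e=\mathrm s(p)$. -/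

import Mathlib

universe u v w

namespace QuiverAlgebra

open Quiver

/-! ### The path algebra of a finite quiver -/

section PathAlgebra

/-- A path of the quiver, of arbitrary length (length `0` included), bundled with its starting
point and its end point. -/
structure QPath (V : Type v) [Quiver.{w} V] : Type (max v w) where
  src : V
  tgt : V
  path : Path src tgt

/-- The underlying vector space of the path algebra: the `k`-vector space with basis the set of
all paths. -/
def PathAlgebra (k : Type u) (V : Type v) [Field k] [Quiver.{w} V] : Type (max u v w) :=
  QPath V →₀ k

variable {k : Type u} {V : Type v} [Field k] [Quiver.{w} V]

noncomputable instance : AddCommGroup (PathAlgebra k V) :=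
  inferInstanceAs (AddCommGroup (QPath V →₀ k))

noncomputable instance : Module k (PathAlgebra k V) :=
  inferInstanceAs (Module k (QPath V →₀ k))

variable (k) in
/-- The basis element of the path algebra given by a bundled path. -/
noncomputable def basisElt (q : QPath V) : PathAlgebra k V := Finsupp.single q (1 : k)

variable (k) in
/-- A path, viewed as an element of the path algebra. -/
noncomputable def ofPath {a b : V} (p : Path a b) : PathAlgebra k V := basisElt k ⟨a, b, p⟩

open Classical in
variable (k) in
/-- The product `q p` of two paths. Paths are composed from right to left: `q p` is `p` followed
by `q` if `p` ends where `q` starts, and `0` otherwise. -/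
noncomputable def pathMul (q p : QPath V) : PathAlgebra k V :=
  if h : p.tgt = q.src then ofPath k (p.path.comp (q.path.cast h.symm rfl)) else 0

/-- The bilinear extension of the product of paths. -/
noncomputable def mulBilin : PathAlgebra k V →ₗ[k] PathAlgebra k V →ₗ[k] PathAlgebra k V :=
  Finsupp.linearCombination k fun q : QPath V =>
    (Finsupp.linearCombination k fun p : QPath V => pathMul k q p :
      (QPath V →₀ k) →ₗ[k] PathAlgebra k V)

noncomputable instance : Mul (PathAlgebra k V) := ⟨fun x y => mulBilin x y⟩

noncomputable instance [Fintype V] : One (PathAlgebra k V) :=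
  ⟨∑ a : V, ofPath k (Path.nil : Path a a)⟩

theorem mul_def (x y : PathAlgebra k V) : x * y = mulBilin x y := rfl

theorem one_def [Fintype V] :
    (1 : PathAlgebra k V) = ∑ a : V, ofPath k (Path.nil : Path a a) := rfl

theorem basisElt_mul_basisElt (q p : QPath V) :
    basisElt k q * basisElt k p = pathMul k q p := by
  rw [mul_def, mulBilin, basisElt, basisElt]
  erw [Finsupp.linearCombination_single, one_smul, Finsupp.linearCombination_single, one_smul]

theorem ofPath_mul_ofPath {a b c : V} (q : Path b c) (p : Path a b) :
    ofPath k q * ofPath k p = ofPath k (p.comp q) := by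
  rw [ofPath, ofPath, basisElt_mul_basisElt, pathMul]
  simp

theorem ofPath_mul_ofPath_of_ne {a b c d : V} (q : Path c d) (p : Path a b) (h : b ≠ c) :
    ofPath k q * ofPath k p = 0 := by
  rw [ofPath, ofPath, basisElt_mul_basisElt, pathMul]
  simp [h]

/-- Induction principle: an additive and homogeneous property of elements of the path algebra
holds as soon as it holds for paths. -/
theorem path_induction {P : PathAlgebra k V → Prop} (x : PathAlgebra k V) (h0 : P 0)
    (hadd : ∀ x y, P x → P y → P (x + y)) (hsmul : ∀ (c : k) x, P x → P (c • x))
    (hpath : ∀ {a b : V} (p : Path a b), P (ofPath k p)) : P x := by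
  refine Finsupp.induction_linear (motive := P) x h0 hadd ?_
  rintro ⟨a, b, p⟩ c
  have : (Finsupp.single (⟨a, b, p⟩ : QPath V) c : QPath V →₀ k)
      = c • (Finsupp.single (⟨a, b, p⟩ : QPath V) (1 : k)) := by simp
  rw [this]
  exact hsmul c _ (hpath p)

theorem add_mul' (x y z : PathAlgebra k V) : (x + y) * z = x * z + y * z := by
  simp [mul_def]

theorem mul_add' (x y z : PathAlgebra k V) : x * (y + z) = x * y + x * z := by
  simp [mul_def]

theorem smul_mul' (c : k) (x y : PathAlgebra k V) : (c • x) * y = c • (x * y) := by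
  simp [mul_def]

theorem mul_smul' (c : k) (x y : PathAlgebra k V) : x * (c • y) = c • (x * y) := by
  simp [mul_def]

theorem zero_mul' (x : PathAlgebra k V) : 0 * x = 0 := by simp [mul_def]

theorem mul_zero' (x : PathAlgebra k V) : x * 0 = 0 := by simp [mul_def]

theorem mul_assoc' (x y z : PathAlgebra k V) : x * y * z = x * (y * z) := by
  refine path_induction (P := fun x => x * y * z = x * (y * z)) x ?_ ?_ ?_ ?_
  · simp only [zero_mul']
  · intro x₁ x₂ h₁ h₂; simp only [add_mul', h₁, h₂]
  · intro c x h; simp only [smul_mul', h]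
  intro a b r
  refine path_induction (P := fun y => ofPath k r * y * z = ofPath k r * (y * z)) y ?_ ?_ ?_ ?_
  · simp only [zero_mul', mul_zero']
  · intro x₁ x₂ h₁ h₂; simp only [add_mul', mul_add', h₁, h₂]
  · intro c x h; simp only [smul_mul', mul_smul', h]
  intro c d q
  refine path_induction
    (P := fun z => ofPath k r * ofPath k q * z = ofPath k r * (ofPath k q * z)) z ?_ ?_ ?_ ?_
  · simp only [mul_zero']
  · intro x₁ x₂ h₁ h₂; simp only [mul_add', h₁, h₂]
  · intro c x h; simp only [mul_smul', h]
  intro e f p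
  by_cases h₁ : d = a
  · subst h₁
    by_cases h₂ : f = c
    · subst h₂
      simp only [ofPath_mul_ofPath, Path.comp_assoc]
    · simp only [ofPath_mul_ofPath, ofPath_mul_ofPath_of_ne _ _ h₂, mul_zero']
  · by_cases h₂ : f = c
    · subst h₂
      simp only [ofPath_mul_ofPath, ofPath_mul_ofPath_of_ne _ _ h₁, zero_mul']
    · simp only [ofPath_mul_ofPath_of_ne _ _ h₁, ofPath_mul_ofPath_of_ne _ _ h₂, zero_mul',
        mul_zero']

theorem one_mul' [Fintype V] (x : PathAlgebra k V) : 1 * x = x := by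
  refine path_induction (P := fun x => 1 * x = x) x (mul_zero' _) ?_ ?_ ?_
  · intro x₁ x₂ h₁ h₂; simp only [mul_add', h₁, h₂]
  · intro c x h; simp only [mul_smul', h]
  intro a b p
  rw [one_def, mul_def, map_sum, LinearMap.sum_apply, Finset.sum_eq_single b]
  · rw [← mul_def, ofPath_mul_ofPath, Path.comp_nil]
  · intro c _ hc
    rw [← mul_def, ofPath_mul_ofPath_of_ne _ _ hc.symm]
  · intro h; exact absurd (Finset.mem_univ b) h

theorem mul_one' [Fintype V] (x : PathAlgebra k V) : x * 1 = x := by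
  refine path_induction (P := fun x => x * 1 = x) x (zero_mul' _) ?_ ?_ ?_
  · intro x₁ x₂ h₁ h₂; simp only [add_mul', h₁, h₂]
  · intro c x h; simp only [smul_mul', h]
  intro a b p
  rw [one_def, mul_def, map_sum, Finset.sum_eq_single a]
  · rw [← mul_def, ofPath_mul_ofPath, Path.nil_comp]
  · intro c _ hc
    rw [← mul_def, ofPath_mul_ofPath_of_ne _ _ hc]
  · intro h; exact absurd (Finset.mem_univ a) h

noncomputable instance [Fintype V] : Ring (PathAlgebra k V) :=
  { (inferInstance : AddCommGroup (PathAlgebra k V)),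
    (inferInstance : Mul (PathAlgebra k V)),
    (inferInstance : One (PathAlgebra k V)) with
    left_distrib := mul_add'
    right_distrib := add_mul'
    zero_mul := zero_mul'
    mul_zero := mul_zero'
    mul_assoc := mul_assoc'
    one_mul := one_mul'
    mul_one := mul_one' }

noncomputable instance [Fintype V] : Algebra k (PathAlgebra k V) :=
  Algebra.ofModule smul_mul' mul_smul'

variable (k V) in
/-- The span of all paths of length at least `m`, which is the `m`-th power of the ideal of the
path algebra generated by the arrows. -/
noncomputable def longPaths (m : ℕ) : Submodule k (PathAlgebra k V) :=
  Submodule.span k {x | ∃ q : QPath V, m ≤ q.path.length ∧ x = basisElt k q}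

/-- An ideal of the path algebra is admissible if it lies between some power of the arrow ideal
and the square of the arrow ideal. -/
def IsAdmissible [Fintype V] (I : Ideal (PathAlgebra k V)) : Prop :=
  (∃ m : ℕ, 2 ≤ m ∧ (longPaths k V m : Set (PathAlgebra k V)) ⊆ I) ∧
    (I : Set (PathAlgebra k V)) ⊆ longPaths k V 2

/-- The class of a path in the quotient `Λ = kΓ/I` of the path algebra. -/
noncomputable def cls [Fintype V] (I : Ideal (PathAlgebra k V)) {a b : V} (p : Path a b) :
    PathAlgebra k V ⧸ I :=
  Submodule.Quotient.mk (ofPath k p)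

end PathAlgebra

/-! ### Combinatorics of paths: right subpaths, detours, routes -/

section Combinatorics

variable {V : Type v} [Quiver.{w} V]

/-- `u` is a right subpath of `p`: there is a path `r` with `p = r u` (first `u`, then `r`). -/
def IsRightSubpath {a b c : V} (u : Path a c) (p : Path a b) : Prop :=
  ∃ r : Path c b, u.comp r = p

/-- `p` starts with an oriented cycle: some right subpath of `p` of positive length is closed. -/
def StartsWithCycle {a b : V} (p : Path a b) : Prop :=
  ∃ c : Path a a, 0 < c.length ∧ IsRightSubpath c p

/-- `(α, u)` is a detour on `p`. -/
def IsDetour {a b c d : V} (p : Path a b) (α : c ⟶ d) (u : Path a c) : Prop :=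
  IsRightSubpath u p ∧ ¬ IsRightSubpath (u.cons α) p ∧
    ∃ v : Path a d, IsRightSubpath v p ∧ u.length + 1 ≤ v.length

/-- `q` is a route on `p`: it starts where `p` starts, and the sequence of vertices through which
it passes is a subsequence of the sequence of vertices of `p`. -/
def IsRoute {a b : V} (p : Path a b) (q : QPath V) : Prop :=
  q.src = a ∧ q.path.vertices.Sublist p.vertices

/-- `q` is a non-route on `p`: it starts where `p` starts, but it is not a route on `p`. -/
def IsNonRoute {a b : V} (p : Path a b) (q : QPath V) : Prop :=
  q.src = a ∧ ¬ IsRoute p q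

end Combinatorics

section Bound

variable {k : Type u} {V : Type v} [Field k] [Quiver.{w} V] [Fintype V]
  (I : Ideal (PathAlgebra k V)) [I.IsTwoSided]

/-- The detour `(α, u)` on `p` is inessential: in `Λ = kΓ/I`, the element `α u` is the sum of a
linear combination of paths none of which is a route on `p`, and of a linear combination of right
subpaths of `p` that are longer than `u` and have the same end point as `α`. -/
def IsInessential {a b c d : V} (p : Path a b) (α : c ⟶ d) (u : Path a c) : Prop :=
  ∃ s ∈ Submodule.span k {x : PathAlgebra k V ⧸ I |
      ∃ q : QPath V, ¬ IsRoute p q ∧ x = cls I q.path},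
  ∃ t ∈ Submodule.span k {x : PathAlgebra k V ⧸ I |
      ∃ v : Path a d, IsRightSubpath v p ∧ u.length < v.length ∧ x = cls I v},
    cls I (u.cons α) = s + t

/-- `Λe`, for the vertex `e`. -/
noncomputable def leftProj (e : V) : Submodule (PathAlgebra k V ⧸ I) (PathAlgebra k V ⧸ I) :=
  Submodule.span _ {cls I (Path.nil : Path e e)}

/-- `Jp = {r p | r ∈ J}`, where `J` is the Jacobson radical of `Λ`. -/
noncomputable def radMulPath {a b : V} (p : Path a b) :
    Submodule (PathAlgebra k V ⧸ I) (PathAlgebra k V ⧸ I) :=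
  Submodule.map (LinearMap.toSpanSingleton (PathAlgebra k V ⧸ I) (PathAlgebra k V ⧸ I) (cls I p))
    (Ring.jacobson (PathAlgebra k V ⧸ I))

end Bound

/-! ### Uniserial modules and irreducible maps -/

section Modules

variable (R : Type u) [Ring R] (M : Type v) [AddCommGroup M] [Module R M]

/-- A module is uniserial if it has exactly one composition series (from `0` to the whole module,
with simple factors). In particular it has finite length. -/
def IsUniserial : Prop :=
  ∃! s : CompositionSeries (Submodule R M), s.head = ⊥ ∧ s.last = ⊤

/-- The submodule `JM`, where `J` is the Jacobson radical of the ring. -/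
def radical : Submodule R M := Ring.jacobson R • (⊤ : Submodule R M)

variable {R M} {N : Type v} [AddCommGroup N] [Module R N]

/-- `f` is a split monomorphism. -/
def IsSplitMonoMap (f : M →ₗ[R] N) : Prop := ∃ g : N →ₗ[R] M, g ∘ₗ f = LinearMap.id

/-- `f` is a split epimorphism. -/
def IsSplitEpiMap (f : M →ₗ[R] N) : Prop := ∃ g : N →ₗ[R] M, f ∘ₗ g = LinearMap.id

/-- A homomorphism of finitely generated modules is irreducible (in the category of finitely
generated modules) if it is neither a split monomorphism nor a split epimorphism, and in each of
its factorizations `f = h ∘ g` through a finitely generated module, `g` is a split monomorphism or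
`h` is a split epimorphism. -/
def IsIrreducibleMap (f : M →ₗ[R] N) : Prop :=
  ¬ IsSplitMonoMap f ∧ ¬ IsSplitEpiMap f ∧
    ∀ (X : Type v) [AddCommGroup X] [Module R X] [Module.Finite R X]
      (g : M →ₗ[R] X) (h : X →ₗ[R] N), h ∘ₗ g = f → IsSplitMonoMap g ∨ IsSplitEpiMap h

end Modules

section Mast

variable {k : Type u} {V : Type v} [Field k] [Quiver.{w} V] [Fintype V]
  (I : Ideal (PathAlgebra k V)) [I.IsTwoSided]

/-- `p` is a mast of the (uniserial) module `U`: the length of `U` is one more than the length of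
`p`, and `p x ≠ 0` for some `x` in `U`. -/
def IsMast {a b : V} (p : Path a b) (U : Type*) [AddCommGroup U]
    [Module (PathAlgebra k V ⧸ I) U] : Prop :=
  Module.length (PathAlgebra k V ⧸ I) U = ((p.length + 1 : ℕ) : ℕ∞) ∧ ∃ x : U, cls I p • x ≠ 0

end Mast

end QuiverAlgebra

open QuiverAlgebra

/-! Let `p x ≠ 0`, `P = Λe`, let `π : P → U` be the projective cover `a ↦ a x`, `K = ker π` and `W =
JU`. Everything follows from `K = Jp`.

Since `p` does not start with a cycle, `e·JU = 0`, that is, `Hom(P, W) = 0`. For `Q ≤ π⁻¹(W)` the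
inclusion `W → U` factors through the quotient of `P × π⁻¹(W)` by `{(a, b) | π a = 0, b - a ∈ Q}`,
via `π b ↦ [(b, b)]` and `[(a, b)] ↦ π a`. A retraction of the first map kills the copy of `P`,
which forces `π Q = 0`. A section of the second lifts to `P` and gives an automorphism of `P`
carrying `K` into `K ∩ Q`, so `K ≤ Q` by finite length (`ker_le_of_isIrreducibleMap`). The choice `Q
= Λp` is not killed by `π`, so `K ≤ Λp`; multiples of `p` are scalar modulo `Jp`, and `p x ≠ 0 = Jp
x`, whence `K = Jp` (`ker_leftProjMap`).

The rest is a computation in `U`. Comparing lengths, `J u x = Λ α u x` whenever `u` is a right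
subpath of `p` and `α` is the next arrow of `p`. Hence for every arrow `α` that can follow `u`, `α u
x` is a combination of elements `v x` with `v` a longer right subpath ending where `α` ends
(`arrow_smul_mem_subpathSpan`). For a detour, `α u` minus the combination of the `v` lies in `K =
Jp`, which is spanned by paths longer than `p`, hence by paths that are not routes. Iterating along
a path `q` from `e`, `q x` is a combination of `v x` where `v` passes through the vertices of `q` in
order (`path_smul_mem_span`); for a non-route no such `v` exists, so `q ∈ K`. -/

namespace QuiverAlgebra

open Quiver

/-! ### Irreducible inclusions and the kernel of a projective cover -/

section Irreducible

variable {R : Type u} [Ring R] {P U : Type v} [AddCommGroup P] [Module R P] [AddCommGroup U]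
  [Module R U]

/-- The relations `{(a, b) | π a = 0, b - a ∈ Q}` on `P × π⁻¹(W)`. -/
def gluingRel (π : P →ₗ[R] U) (W : Submodule R U) (Q : Submodule R P) :
    Submodule R (P × W.comap π) :=
  LinearMap.ker (π ∘ₗ LinearMap.fst R P (W.comap π)) ⊓
    Q.comap ((W.comap π).subtype ∘ₗ LinearMap.snd R P (W.comap π) -
      LinearMap.fst R P (W.comap π))

theorem mem_gluingRel {π : P →ₗ[R] U} {W : Submodule R U} {Q : Submodule R P}
    {z : P × W.comap π} : z ∈ gluingRel π W Q ↔ π z.1 = 0 ∧ (z.2 : P) - z.1 ∈ Q := by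
  simp [gluingRel]

/-- Nakayama's lemma: the radical of a noetherian module is superfluous. -/
theorem eq_top_of_sup_jacobson_eq_top [IsNoetherian R P] {N : Submodule R P}
    (h : N ⊔ Module.jacobson R P = ⊤) : N = ⊤ := by
  rcases eq_top_or_exists_le_coatom N with hN | ⟨M, hM, hNM⟩
  · exact hN
  · exact absurd (top_unique (h ▸ sup_le hNM (sInf_le hM))) hM.1

/-- An artinian submodule which is mapped into itself and into `Q` by an injective endomorphism is
contained in `Q`. -/
theorem le_of_injective_of_mapsTo {φ : P →ₗ[R] P} (hφ : Function.Injective φ)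
    {K Q : Submodule R P} [IsArtinian R K] (hK : ∀ m ∈ K, φ m ∈ K) (hQ : ∀ m ∈ K, φ m ∈ Q) :
    K ≤ Q := by
  have hinj : Function.Injective (φ.restrict hK) := fun a b hab =>
    Subtype.ext (hφ (congrArg Subtype.val hab))
  intro m hm
  obtain ⟨n, hn⟩ := IsArtinian.surjective_of_injective_endomorphism _ hinj ⟨m, hm⟩
  have : φ n = m := congrArg Subtype.val hn
  exact this ▸ hQ n n.2

/-- If the inclusion `W → U` is irreducible and `π : P → U` is a projective cover with
`Hom(P, W) = 0`, then each submodule of `π⁻¹(W)` which is not contained in the kernel of `π`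
contains the kernel of `π`. -/
theorem ker_le_of_isIrreducibleMap [IsNoetherian R P] [IsArtinian R P] [Module.Projective R P]
    {π : P →ₗ[R] U} (hπ : Function.Surjective π)
    (hK : LinearMap.ker π ≤ Module.jacobson R P)
    {W : Submodule R U} (hW : IsIrreducibleMap W.subtype) (hom : ∀ φ : P →ₗ[R] W, φ = 0)
    {Q : Submodule R P} (hQW : Q ≤ W.comap π) (hQ : ¬ Q ≤ LinearMap.ker π) :
    LinearMap.ker π ≤ Q := by
  let B := W.comap π
  let rel := gluingRel π W Q
  let πB : B →ₗ[R] W := π.restrict fun _ hb => hb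
  have hπB : Function.Surjective πB := by
    rintro ⟨y, hy⟩
    obtain ⟨a, rfl⟩ := hπ y
    exact ⟨⟨a, hy⟩, rfl⟩
  let d : B →ₗ[R] (P × B) ⧸ rel := rel.mkQ ∘ₗ B.subtype.prod LinearMap.id
  have hd : LinearMap.ker πB ≤ LinearMap.ker d := by
    intro b hb
    have hb' : π b = 0 := congrArg Subtype.val (LinearMap.mem_ker.1 hb)
    rw [LinearMap.mem_ker]
    refine (Submodule.Quotient.mk_eq_zero _).2 (mem_gluingRel.2 ⟨hb', ?_⟩)
    simp
  -- `g` sends `π b` to the class of `(b, b)`; this is well defined because `(b, b)` is a relation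
  -- whenever `π b = 0`.
  let g : W →ₗ[R] (P × B) ⧸ rel :=
    (LinearMap.ker πB).liftQ d hd ∘ₗ (πB.quotKerEquivOfSurjective hπB).symm.toLinearMap
  have hg (b : B) : g (πB b) = rel.mkQ (b, b) := by
    have : (πB.quotKerEquivOfSurjective hπB).symm (πB b) = (LinearMap.ker πB).mkQ b := by
      rw [LinearEquiv.symm_apply_eq]; rfl
    simp only [g, LinearMap.comp_apply, LinearEquiv.coe_coe, this]
    rfl
  let h : (P × B) ⧸ rel →ₗ[R] U := rel.liftQ (π ∘ₗ LinearMap.fst R P B) inf_le_left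
  have hh (z : P × B) : h (rel.mkQ z) = π z.1 := rfl
  have hhg : h ∘ₗ g = W.subtype := by
    ext y
    obtain ⟨b, rfl⟩ := hπB y
    rw [LinearMap.comp_apply, hg]
    rfl
  rcases hW.2.2 _ g h hhg with ⟨ρ, hρ⟩ | ⟨σ, hσ⟩
  -- For `q ∈ Q` the pair `(0, q)` is a relation, so `(q, q)` and `(q, 0)` have the same class. The
  -- retraction `ρ` sends it to `π q` by the first description, and to `0` by the second, as `Hom(P,
  -- W) = 0`.
  · refine absurd (fun q hq => ?_) hQ
    have h1 : ρ (rel.mkQ (q, 0)) = 0 :=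
      LinearMap.congr_fun (hom (ρ ∘ₗ rel.mkQ ∘ₗ LinearMap.inl R P B)) q
    have h2 : ρ (rel.mkQ (q, ⟨q, hQW hq⟩)) = πB ⟨q, hQW hq⟩ := by
      rw [← hg ⟨q, hQW hq⟩]
      exact LinearMap.congr_fun hρ _
    have h3 : rel.mkQ ((q, ⟨q, hQW hq⟩) - (q, 0)) = 0 :=
      (Submodule.Quotient.mk_eq_zero _).2 (mem_gluingRel.2 (by simpa using hq))
    rw [map_sub, sub_eq_zero] at h3
    rw [h3, h1] at h2
    exact (congrArg Subtype.val h2).symm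
  · obtain ⟨τ, hτ⟩ := Module.projective_lifting_property rel.mkQ (σ ∘ₗ π)
      (Submodule.mkQ_surjective _)
    have hτ1 (a : P) : π (τ a).1 = π a := by
      rw [← hh, show rel.mkQ (τ a) = σ (π a) from LinearMap.congr_fun hτ a]
      exact LinearMap.congr_fun hσ _
    have hτ2 (a : P) : π (τ a).2 = 0 :=
      congrArg Subtype.val (LinearMap.congr_fun
        (hom (πB ∘ₗ LinearMap.snd R P B ∘ₗ τ)) a)
    -- This difference is the one in the definition of the relations: `φ a ∈ Q` as soon as `τ a` is
    -- a relation. Moreover `π ∘ φ = -π`, so `φ` is onto modulo the superfluous kernel, hence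
    -- bijective.
    let φ : P →ₗ[R] P := (B.subtype ∘ₗ LinearMap.snd R P B - LinearMap.fst R P B) ∘ₗ τ
    have hφ (a : P) : φ a = (τ a).2 - (τ a).1 := rfl
    have hπφ (a : P) : π (φ a) = - π a := by rw [hφ, map_sub, hτ1, hτ2, zero_sub]
    have htop : LinearMap.range φ = ⊤ := by
      refine eq_top_of_sup_jacobson_eq_top (eq_top_iff.2 fun a _ => ?_)
      refine (sup_le_sup_left hK _) (Submodule.mem_sup.2
        ⟨φ (-a), ⟨-a, rfl⟩, a - φ (-a), ?_, by abel⟩)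
      rw [LinearMap.mem_ker, map_sub, hπφ, map_neg, neg_neg, sub_self]
    have hsurj : Function.Surjective φ := LinearMap.range_eq_top.1 htop
    refine le_of_injective_of_mapsTo
      (IsNoetherian.injective_of_surjective_endomorphism φ hsurj) (fun m hm => ?_) fun m hm => ?_
    · rw [LinearMap.mem_ker, hπφ, hm, neg_zero]
    · have : rel.mkQ (τ m) = 0 := by
        rw [show rel.mkQ (τ m) = σ (π m) from LinearMap.congr_fun hτ m, LinearMap.mem_ker.1 hm,
          map_zero]
      exact (mem_gluingRel.1 ((Submodule.Quotient.mk_eq_zero _).1 this)).2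

end Irreducible

/-! ### Paths in `kΓ/I`: finite dimension and the Jacobson radical -/

section Algebra

variable {k : Type u} {V : Type v} [Field k] [Quiver.{w} V] [Fintype V]
  (I : Ideal (PathAlgebra k V))

theorem mem_span_cls (x : PathAlgebra k V ⧸ I) :
    x ∈ Submodule.span k {y | ∃ q : QPath V, y = cls I q.path} := by
  obtain ⟨x, rfl⟩ := Submodule.Quotient.mk_surjective _ x
  refine path_induction (P := fun x => (Submodule.Quotient.mk x : PathAlgebra k V ⧸ I) ∈
    Submodule.span k {y | ∃ q : QPath V, y = cls I q.path}) x ?_ ?_ ?_ ?_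
  · exact zero_mem _
  · intro x y hx hy; exact add_mem hx hy
  · intro c x hx; exact Submodule.smul_mem _ c hx
  · intro a b p; exact Submodule.subset_span ⟨⟨a, b, p⟩, rfl⟩

variable (k V) in
theorem finite_paths_length [∀ a b : V, Finite (a ⟶ b)] (n : ℕ) (a : V) :
    ∀ b : V, Finite {p : Path a b // p.length = n} := by
  induction n with
  | zero =>
    intro b
    refine @Finite.of_subsingleton _ ⟨?_⟩
    rintro ⟨p, hp⟩ ⟨q, hq⟩
    obtain rfl := Path.eq_of_length_zero p hp
    exact Subtype.ext ((Path.eq_nil_of_length_zero p hp).trans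
      (Path.eq_nil_of_length_zero q hq).symm)
  | succ n ih =>
    intro b
    have := ih
    refine Finite.of_surjective
      (α := Σ c : V, {p : Path a c // p.length = n} × (c ⟶ b))
      (fun x => ⟨x.2.1.1.cons x.2.2, by simp [x.2.1.2]⟩) ?_
    rintro ⟨p, hp⟩
    cases p with
    | nil => simp at hp
    | cons p α => exact ⟨⟨_, ⟨p, by simpa using hp⟩, α⟩, rfl⟩

/-- The `k`-span of the classes of the paths of length at least `n`. -/
noncomputable def longCls (n : ℕ) : Submodule k (PathAlgebra k V ⧸ I) :=
  Submodule.span k {x | ∃ q : QPath V, n ≤ q.path.length ∧ x = cls I q.path}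

variable {I}

theorem cls_mem_longCls {n : ℕ} {a b : V} (p : Path a b) (h : n ≤ p.length) :
    cls I p ∈ longCls I n := Submodule.subset_span ⟨⟨a, b, p⟩, h, rfl⟩

theorem mem_longCls_zero (x : PathAlgebra k V ⧸ I) : x ∈ longCls I 0 := by
  refine Submodule.span_mono ?_ (mem_span_cls I x)
  rintro _ ⟨q, rfl⟩
  exact ⟨q, Nat.zero_le _, rfl⟩

theorem longCls_eq_bot {m : ℕ} (hm : (longPaths k V m : Set (PathAlgebra k V)) ⊆ I) :
    longCls I m = ⊥ := by
  refine (Submodule.eq_bot_iff _).2 fun x hx => ?_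
  refine (Submodule.mem_bot k).1 (Submodule.span_le.2 ?_ hx)
  rintro _ ⟨q, hq, rfl⟩
  exact (Submodule.Quotient.mk_eq_zero _).2 (hm (Submodule.subset_span ⟨q, hq, rfl⟩))

/-- The coefficient at a trivial path vanishes on combinations of paths of length at least `2`,
hence on `I`. -/
theorem cls_nil_ne_zero (hI : IsAdmissible I) (a : V) : cls I (Path.nil : Path a a) ≠ 0 := by
  intro h
  have h2 : (ofPath k (Path.nil : Path a a)) ∈ longPaths k V 2 :=
    hI.2 ((Submodule.Quotient.mk_eq_zero _).1 h)
  let φ : PathAlgebra k V →ₗ[k] k := Finsupp.lapply (⟨a, a, Path.nil⟩ : QPath V)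
  have h3 : longPaths k V 2 ≤ LinearMap.ker φ := by
    refine Submodule.span_le.2 ?_
    rintro _ ⟨q, hq, rfl⟩
    refine Finsupp.single_eq_of_ne ?_
    rintro rfl
    simp at hq
  have h4 : φ (ofPath k (Path.nil : Path a a)) = 0 := h3 h2
  exact one_ne_zero ((Finsupp.single_eq_same (M := k)).symm.trans h4)

theorem finite_quotient [∀ a b : V, Finite (a ⟶ b)] (hI : IsAdmissible I) :
    Module.Finite k (PathAlgebra k V ⧸ I) := by
  obtain ⟨m, -, hm⟩ := hI.1
  let T := Σ (i : Fin m) (a b : V), {p : Path a b // p.length = i}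
  have (i : Fin m) (a b : V) : Finite {p : Path a b // p.length = i} :=
    finite_paths_length V i a b
  refine ⟨(Submodule.fg_def.2 ⟨Set.range fun t : T => cls I t.2.2.2.1, Set.finite_range _, ?_⟩)⟩
  refine eq_top_iff.2 fun x _ => Submodule.span_le.2 ?_ (mem_span_cls I x)
  rintro _ ⟨⟨a, b, q⟩, rfl⟩
  by_cases h : q.length < m
  · exact Submodule.subset_span ⟨⟨⟨_, h⟩, a, b, q, rfl⟩, rfl⟩
  · have : cls I q ∈ longCls I m := cls_mem_longCls q (not_lt.1 h)
    rw [longCls_eq_bot hm, Submodule.mem_bot] at this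
    exact this ▸ zero_mem _

variable [I.IsTwoSided]

theorem cls_mul_cls {a b c : V} (q : Path b c) (p : Path a b) :
    cls I q * cls I p = cls I (p.comp q) :=
  congrArg (Ideal.Quotient.mk I) (ofPath_mul_ofPath q p)

theorem cls_mul_cls_of_ne {a b c d : V} (q : Path c d) (p : Path a b) (h : b ≠ c) :
    cls I q * cls I p = 0 :=
  congrArg (Ideal.Quotient.mk I) (ofPath_mul_ofPath_of_ne q p h)

theorem one_eq_sum_cls : (1 : PathAlgebra k V ⧸ I) = ∑ a : V, cls I (Path.nil : Path a a) := by
  change Ideal.Quotient.mk I 1 = _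
  rw [one_def, map_sum]
  rfl

theorem cls_mul_cls_mem (q q' : QPath V) :
    cls I q.path * cls I q'.path = 0 ∨
      ∃ q'' : QPath V, q''.path.length = q.path.length + q'.path.length ∧ q''.src = q'.src ∧
        cls I q.path * cls I q'.path = cls I q''.path := by
  obtain ⟨a, b, q⟩ := q
  obtain ⟨c, d, q'⟩ := q'
  by_cases h : d = a
  · subst h
    exact .inr ⟨⟨_, _, q'.comp q⟩, by simp [add_comm], rfl, cls_mul_cls q q'⟩
  · exact .inl (cls_mul_cls_of_ne q q' h)

theorem mul_mem_longCls {m n : ℕ} {x y : PathAlgebra k V ⧸ I} (hx : x ∈ longCls I m)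
    (hy : y ∈ longCls I n) : x * y ∈ longCls I (m + n) := by
  refine Submodule.span_induction₂ (p := fun x y _ _ => x * y ∈ longCls I (m + n))
    ?_ ?_ ?_ ?_ ?_ ?_ ?_ hx hy
  · rintro _ _ ⟨q, hq, rfl⟩ ⟨q', hq', rfl⟩
    rcases cls_mul_cls_mem (I := I) q q' with h | ⟨q'', hl, -, h⟩
    · rw [h]; exact zero_mem _
    · rw [h]; exact cls_mem_longCls _ (by omega)
  · intro y _; rw [zero_mul]; exact zero_mem _
  · intro x _; rw [mul_zero]; exact zero_mem _
  · intro x y z _ _ _ hx hy; rw [add_mul]; exact add_mem hx hy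
  · intro x y z _ _ _ hx hy; rw [mul_add]; exact add_mem hx hy
  · intro c x y _ _ h; rw [smul_mul_assoc]; exact Submodule.smul_mem _ _ h
  · intro c x y _ _ h; rw [mul_smul_comm]; exact Submodule.smul_mem _ _ h

theorem isNilpotent_of_mem_longCls (hI : IsAdmissible I) {x : PathAlgebra k V ⧸ I}
    (hx : x ∈ longCls I 1) : IsNilpotent x := by
  obtain ⟨m, -, hm⟩ := hI.1
  have (n : ℕ) : x ^ n ∈ longCls I n := by
    induction n with
    | zero => exact mem_longCls_zero _
    | succ n ih => rw [pow_succ]; exact mul_mem_longCls ih hx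
  exact ⟨m, by simpa [longCls_eq_bot hm] using this m⟩

theorem mem_jacobson_of_mem_longCls (hI : IsAdmissible I) {x : PathAlgebra k V ⧸ I}
    (hx : x ∈ longCls I 1) : x ∈ Ring.jacobson (PathAlgebra k V ⧸ I) := by
  rw [← Ideal.jacobson_bot, Ideal.mem_jacobson_iff]
  intro y
  have hyx : IsNilpotent (y * x) :=
    isNilpotent_of_mem_longCls hI (by simpa using mul_mem_longCls (mem_longCls_zero y) hx)
  obtain ⟨z, hz⟩ := hyx.isUnit_one_add.exists_left_inv
  refine ⟨z, ?_⟩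
  rw [Ideal.mem_bot, mul_assoc, ← hz]
  noncomm_ring

/-- An idempotent of the Jacobson radical vanishes. -/
theorem eq_zero_of_mem_jacobson_of_isIdempotentElem {R : Type*} [Ring R] {x : R}
    (hx : x ∈ Ring.jacobson R) (h : x * x = x) : x = 0 := by
  rw [← Ideal.jacobson_bot, Ideal.mem_jacobson_iff] at hx
  -- With `-1`, the element `z` is a left inverse of `1 - x`, which annihilates `x` from the left.
  obtain ⟨z, hz⟩ := hx (-1)
  rw [Ideal.mem_bot] at hz
  have hz' : (z * -1 * x + z - 1) * x = 0 := by rw [hz, zero_mul]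
  have : (z * -1 * x + z - 1) * x = z * (x - x * x) - x := by noncomm_ring
  rw [hz', h, sub_self, mul_zero, zero_sub] at this
  exact (neg_eq_zero.1 this.symm)

/-- Modulo the paths of positive length, multiples of a trivial path are scalar multiples. -/
theorem exists_smul_add_mem_longCls (x : PathAlgebra k V ⧸ I) (a : V) :
    ∃ c : k, ∃ n ∈ longCls I 1, x * cls I (Path.nil : Path a a) =
      c • cls I (Path.nil : Path a a) + n := by
  refine Submodule.span_induction (p := fun x _ => ∃ c : k, ∃ n ∈ longCls I 1,
    x * cls I (Path.nil : Path a a) = c • cls I (Path.nil : Path a a) + n) ?_ ?_ ?_ ?_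
    (mem_span_cls I x)
  · rintro _ ⟨⟨b, c, q⟩, rfl⟩
    by_cases h : a = b
    · subst h
      cases q with
      | nil => exact ⟨1, 0, zero_mem _, by simp [cls_mul_cls]⟩
      | cons q α =>
        exact ⟨0, _, cls_mem_longCls (q.cons α) (by simp), by simp [cls_mul_cls]⟩
    · exact ⟨0, 0, zero_mem _, by simp [cls_mul_cls_of_ne _ _ h]⟩
  · exact ⟨0, 0, zero_mem _, by simp⟩
  · rintro x y - - ⟨c, n, hn, hx⟩ ⟨d, m, hm, hy⟩
    exact ⟨c + d, n + m, add_mem hn hm, by rw [add_mul, hx, hy, add_smul]; abel⟩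
  · rintro t x - ⟨c, n, hn, hx⟩
    exact ⟨t * c, t • n, Submodule.smul_mem _ _ hn, by
      rw [smul_mul_assoc, hx, smul_add, mul_smul]⟩

/-- If `x` in the radical had a nonzero coefficient at a trivial path, that nonzero idempotent would
itself lie in the radical. -/
theorem mem_jacobson_iff_mem_longCls (hI : IsAdmissible I) {x : PathAlgebra k V ⧸ I} :
    x ∈ Ring.jacobson (PathAlgebra k V ⧸ I) ↔ x ∈ longCls I 1 := by
  refine ⟨fun hx => ?_, mem_jacobson_of_mem_longCls hI⟩
  rw [← mul_one x, one_eq_sum_cls, Finset.mul_sum]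
  refine Submodule.sum_mem _ fun a _ => ?_
  obtain ⟨c, n, hn, h⟩ := exists_smul_add_mem_longCls x a
  rw [h]
  refine add_mem ?_ hn
  by_cases hc : c = 0
  · rw [hc, zero_smul]; exact zero_mem _
  · refine absurd (eq_zero_of_mem_jacobson_of_isIdempotentElem ?_ ?_) (cls_nil_ne_zero hI a)
    · have : cls I (Path.nil : Path a a) = algebraMap k _ c⁻¹ * (x * cls I (Path.nil : Path a a) - n) := by
        rw [h, add_sub_cancel_right, ← Algebra.smul_def, inv_smul_smul₀ hc]
      rw [this]
      exact Ideal.mul_mem_left _ _ (sub_mem (Ideal.mul_mem_right _ _ hx)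
        (mem_jacobson_of_mem_longCls hI hn))
    · rw [cls_mul_cls, Path.nil_comp]

end Algebra
-- Nakayama's lemma for cyclic modules
section Radical

variable {R : Type*} [Ring R] {U : Type*} [AddCommGroup U] [Module R U]

variable (R) in
/-- The submodule `Jy`, where `J` is the Jacobson radical. -/
def radSpan (y : U) : Submodule R U :=
  Submodule.map (LinearMap.toSpanSingleton R U y) (Ring.jacobson R)

theorem notMem_radSpan_self {y : U} (hy : y ≠ 0) : y ∉ radSpan R y := by
  rintro ⟨n, hn, h⟩
  change n ∈ Ring.jacobson R at hn
  change n • y = y at h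
  rw [← Ideal.jacobson_bot, Ideal.mem_jacobson_iff] at hn
  -- Again `z` is a left inverse of `1 - n`, and `(1 - n) y = 0`.
  obtain ⟨z, hz⟩ := hn (-1)
  rw [Ideal.mem_bot] at hz
  have hz' : (z * -1 * n + z - 1) • y = 0 := by rw [hz, zero_smul]
  have : z * -1 * n + z - 1 = z * (1 - n) - 1 := by noncomm_ring
  rw [this, sub_smul, mul_smul, sub_smul, one_smul, h, sub_self, smul_zero, zero_sub] at hz'
  exact hy (neg_eq_zero.1 hz')

theorem radSpan_lt_span {y : U} (hy : y ≠ 0) : radSpan R y < Submodule.span R {y} := by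
  refine lt_of_le_of_ne ?_ fun h => ?_
  · rintro _ ⟨n, -, rfl⟩
    exact Submodule.smul_mem _ n (Submodule.mem_span_singleton_self y)
  · exact notMem_radSpan_self hy (h ▸ Submodule.mem_span_singleton_self y)

theorem radical_eq_radSpan {R : Type u} [Ring R] {U : Type v} [AddCommGroup U] [Module R U]
    {x : U} (hx : Submodule.span R {x} = ⊤) :
    radical R U = radSpan R x := by
  refine le_antisymm (Submodule.smul_le.2 fun n hn z _ => ?_) ?_
  · obtain ⟨a, rfl⟩ := Submodule.mem_span_singleton.1 (hx ▸ Submodule.mem_top : z ∈ _)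
    exact ⟨n * a, Ideal.mul_mem_right _ _ hn, mul_smul _ _ _⟩
  · rintro _ ⟨n, hn, rfl⟩
    exact Submodule.smul_mem_smul hn Submodule.mem_top

end Radical

/-! ### Spans of right subpaths of the mast -/

section SubpathSpan

variable {k : Type u} {V : Type v} [Field k] [Quiver.{w} V] [Fintype V]
  (I : Ideal (PathAlgebra k V)) {e f : V} (p : Path e f)

/-- The `k`-span of the right subpaths of `p` which have length at least `m` and end in `d`. -/
noncomputable def subpathSpan (m : ℕ) (d : V) : Submodule k (PathAlgebra k V ⧸ I) :=
  Submodule.span k {y | ∃ v : Path e d, IsRightSubpath v p ∧ m ≤ v.length ∧ y = cls I v}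

/-- The `k`-span of the right subpaths of `p` which have length at least `m`. -/
noncomputable def subpathSpanAll (m : ℕ) : Submodule k (PathAlgebra k V ⧸ I) :=
  Submodule.span k
    {y | ∃ (d : V) (v : Path e d), IsRightSubpath v p ∧ m ≤ v.length ∧ y = cls I v}

variable {I p}

theorem subpathSpanAll_mono {m n : ℕ} (h : m ≤ n) :
    subpathSpanAll I p n ≤ subpathSpanAll I p m :=
  Submodule.span_mono fun _ ⟨d, v, hv, hn, hy⟩ => ⟨d, v, hv, h.trans hn, hy⟩

end SubpathSpan

/-! ### Uniserial structure read off from the mast -/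

section Mast

variable {k : Type u} {V : Type v} [Field k] [Quiver.{w} V] [Fintype V]
  {I : Ideal (PathAlgebra k V)} [I.IsTwoSided]
  {U : Type*} [AddCommGroup U] [Module (PathAlgebra k V ⧸ I) U]

theorem cls_cons_smul {a b c : V} (u : Path a b) (α : b ⟶ c) (y : U) :
    cls I (u.cons α) • y = cls I α.toPath • cls I u • y := by
  rw [smul_smul, cls_mul_cls, Path.comp_toPath_eq_cons]

theorem cls_cons_smul_mem_radSpan (hI : IsAdmissible I) {a b c : V} (u : Path a b) (α : b ⟶ c)
    (y : U) : cls I (u.cons α) • y ∈ radSpan (PathAlgebra k V ⧸ I) (cls I u • y) :=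
  ⟨_, mem_jacobson_of_mem_longCls hI (cls_mem_longCls α.toPath (by simp)),
    (cls_cons_smul u α y).symm⟩

/-- Each arrow lies in the radical, so by Nakayama it strictly shrinks the cyclic submodule as long
as the result is nonzero. -/
theorem height_span_add_length_le [FiniteDimensionalOrder (Submodule (PathAlgebra k V ⧸ I) U)]
    (hI : IsAdmissible I) {a b : V} (r : Path a b) {y : U}
    (hy : cls I r • y ≠ 0) :
    Order.height (Submodule.span (PathAlgebra k V ⧸ I) {cls I r • y}) + r.length ≤
      Order.height (Submodule.span (PathAlgebra k V ⧸ I) {y}) := by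
  induction r with
  | nil =>
    simp only [Path.length_nil, Nat.cast_zero, add_zero]
    refine Order.height_mono ((Submodule.span_singleton_le_iff_mem _ _).2 ?_)
    exact Submodule.smul_mem _ _ (Submodule.mem_span_singleton_self y)
  | cons r α ih =>
    have hr : cls I r • y ≠ 0 := fun h => hy (by rw [cls_cons_smul, h, smul_zero])
    refine le_trans ?_ (ih hr)
    have hlt : Submodule.span (PathAlgebra k V ⧸ I) {cls I (r.cons α) • y} < Submodule.span (PathAlgebra k V ⧸ I) {cls I r • y} :=
      lt_of_le_of_lt ((Submodule.span_singleton_le_iff_mem _ _).2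
        (cls_cons_smul_mem_radSpan hI r α y)) (radSpan_lt_span hr)
    rw [Path.length_cons, Nat.cast_add, Nat.cast_one, add_comm (r.length : ℕ∞), ← add_assoc]
    exact add_le_add_left (Order.height_add_one_le hlt) _

variable {e f : V} {p : Path e f} {x : U}

section Length

variable (hI : IsAdmissible I)
  (hlen : Module.length (PathAlgebra k V ⧸ I) U = ((p.length + 1 : ℕ) : ℕ∞)) (hpx : cls I p • x ≠ 0)

include hlen in
theorem finiteDimensionalOrder_of_length : FiniteDimensionalOrder (Submodule (PathAlgebra k V ⧸ I) U) :=
  Module.length_ne_top_iff_finiteDimensionalOrder.1 (hlen ▸ ENat.natCast_ne_top _)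

theorem cls_smul_ne_zero_of_comp {c : V} {u : Path e c} {r : Path c f} (h : u.comp r = p)
    (hpx : cls I p • x ≠ 0) : cls I u • x ≠ 0 := fun h0 =>
  hpx (by rw [← h, ← cls_mul_cls, mul_smul, h0, smul_zero])

include hI hlen hpx in
-- Descending from `u x` to `p x ≠ 0` along `r` bounds the height from below; descending from `x` to
-- `u x` inside `U` bounds it from above. The two bounds agree because `U` has length `p.length +
-- 1`.
theorem height_span_cls_smul {c : V} {u : Path e c} {r : Path c f} (h : u.comp r = p) :
    Order.height (Submodule.span (PathAlgebra k V ⧸ I) {cls I u • x}) = ((r.length + 1 : ℕ) : ℕ∞) := by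
  have := finiteDimensionalOrder_of_length hlen
  have hu := cls_smul_ne_zero_of_comp h hpx
  have hrux : cls I r • cls I u • x = cls I p • x := by rw [smul_smul, cls_mul_cls, h]
  have h1 := height_span_add_length_le hI r (y := cls I u • x) (hrux ▸ hpx)
  have h2 := height_span_add_length_le hI u (y := x) hu
  have h3 : (1 : ℕ∞) ≤ Order.height (Submodule.span (PathAlgebra k V ⧸ I) {cls I r • cls I u • x}) := by
    rw [Order.one_le_iff_ne_zero, hrux, ne_eq, Order.height_eq_zero, isMin_iff_eq_bot,
      Submodule.span_singleton_eq_bot]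
    exact hpx
  have h4 : Order.height (Submodule.span (PathAlgebra k V ⧸ I) {x}) ≤ ((p.length + 1 : ℕ) : ℕ∞) :=
    hlen ▸ (Module.length_eq_height (R := (PathAlgebra k V ⧸ I)) (M := U)) ▸ Order.height_mono le_top
  have hne : Order.height (Submodule.span (PathAlgebra k V ⧸ I) {cls I u • x}) ≠ ⊤ := fun htop => by
    rw [htop, top_add, top_le_iff] at h2
    rw [h2] at h4
    exact ENat.natCast_ne_top _ (top_le_iff.1 h4)
  have h5 := h2.trans h4
  have h6 := (add_le_add_left h3 _).trans h1
  lift Order.height (Submodule.span (PathAlgebra k V ⧸ I) {cls I u • x}) to ℕ using hne with n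
  rw [← h, Path.length_comp] at h5
  norm_cast at h5 h6 ⊢
  omega

include hI hlen hpx in
theorem span_eq_top_of_mast : Submodule.span (PathAlgebra k V ⧸ I) {cls I (Path.nil : Path e e) • x} = ⊤ := by
  have := finiteDimensionalOrder_of_length hlen
  by_contra hne
  have h := Order.height_strictMono (lt_top_iff_ne_top.2 hne) (by
    rw [height_span_cls_smul hI hlen hpx (Path.nil_comp p)]; exact ENat.natCast_lt_top _)
  rw [height_span_cls_smul hI hlen hpx (Path.nil_comp p), ← Module.length_eq_height, hlen] at h
  exact lt_irrefl _ h

include hI hlen hpx in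
-- In `Λ α u x ≤ J u x < Λ u x` the heights of the outer terms differ by one, which leaves no room
-- for a strict first inclusion.
theorem radSpan_cls_smul {c d : V} {u : Path e c} {α : c ⟶ d} {r : Path d f}
    (h : (u.cons α).comp r = p) :
    radSpan (PathAlgebra k V ⧸ I) (cls I u • x) = Submodule.span (PathAlgebra k V ⧸ I) {cls I (u.cons α) • x} := by
  have := finiteDimensionalOrder_of_length hlen
  have h' : u.comp (α.toPath.comp r) = p := by
    rw [← Path.comp_assoc, Path.comp_toPath_eq_cons, h]
  by_contra hne
  have h1 := lt_of_le_of_ne ((Submodule.span_singleton_le_iff_mem _ _).2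
    (cls_cons_smul_mem_radSpan hI u α x)) (Ne.symm hne)
  have h2 := radSpan_lt_span (R := (PathAlgebra k V ⧸ I)) (cls_smul_ne_zero_of_comp h' hpx)
  have h3 := (add_le_add_left (Order.height_add_one_le h1) 1).trans (Order.height_add_one_le h2)
  rw [height_span_cls_smul hI hlen hpx h, height_span_cls_smul hI hlen hpx h'] at h3
  rw [Path.length_comp, Path.length_toPath] at h3
  norm_cast at h3
  omega

include hI hlen hpx in
theorem radSpan_mast_smul : radSpan (PathAlgebra k V ⧸ I) (cls I p • x) = ⊥ := by
  have := finiteDimensionalOrder_of_length hlen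
  have h2 := Order.height_add_one_le (radSpan_lt_span (R := (PathAlgebra k V ⧸ I)) hpx)
  rw [height_span_cls_smul hI hlen hpx (Path.comp_nil p)] at h2
  rw [← isMin_iff_eq_bot, ← Order.height_eq_zero]
  refine nonpos_iff_eq_zero.1 ((ENat.add_le_add_iff_right ENat.one_ne_top).1 ?_)
  simpa using h2

theorem nil_mul_mem_subpathSpan {m : ℕ} {t : (PathAlgebra k V ⧸ I)} (ht : t ∈ subpathSpanAll I p m) (d : V) :
    cls I (Path.nil : Path d d) * t ∈ subpathSpan I p m d := by
  refine Submodule.span_induction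
    (p := fun t _ => cls I (Path.nil : Path d d) * t ∈ subpathSpan I p m d) ?_ ?_ ?_ ?_ ht
  · rintro _ ⟨c, v, hv, hm, rfl⟩
    by_cases h : c = d
    · subst h
      rw [cls_mul_cls, Path.comp_nil]
      exact Submodule.subset_span ⟨v, hv, hm, rfl⟩
    · rw [cls_mul_cls_of_ne _ _ h]; exact zero_mem _
  · rw [mul_zero]; exact zero_mem _
  · intro a b _ _ ha hb; rw [mul_add]; exact add_mem ha hb
  · intro c a _ ha; rw [mul_smul_comm]; exact Submodule.smul_mem _ _ ha

theorem exists_smul_add_mem_jacobson (hI : IsAdmissible I) (a : (PathAlgebra k V ⧸ I)) {b c : V} (u : Path b c) :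
    ∃ t : k, ∃ n ∈ Ring.jacobson (PathAlgebra k V ⧸ I), a * cls I u = t • cls I u + n * cls I u := by
  obtain ⟨t, n, hn, h⟩ := exists_smul_add_mem_longCls a c
  refine ⟨t, n, mem_jacobson_of_mem_longCls hI hn, ?_⟩
  have hu : cls I (Path.nil : Path c c) * cls I u = cls I u := by rw [cls_mul_cls, Path.comp_nil]
  have := congrArg (· * cls I u) h
  simpa only [mul_assoc, add_mul, hu, smul_mul_assoc] using this

include hI hlen hpx in
-- Induction on the part `r` of `p` that remains after `u`. An element of `J u x` is a multiple of
-- `α u x` for the next arrow `α` of `p`; its scalar part is recorded, its radical part is passed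
-- on. The process stops because `J p x = 0`.
theorem jacobson_smul_mem_subpathSpanAll {l : ℕ} : ∀ {c : V} {u : Path e c} {r : Path c f},
    u.comp r = p → r.length = l → ∀ n ∈ Ring.jacobson (PathAlgebra k V ⧸ I),
      ∃ t ∈ subpathSpanAll I p (u.length + 1), n • cls I u • x = t • x := by
  induction l with
  | zero =>
    intro c u r h hr n hn
    obtain rfl := Path.eq_of_length_zero r hr
    obtain rfl := Path.eq_nil_of_length_zero r hr
    rw [Path.comp_nil] at h
    subst h
    refine ⟨0, zero_mem _, ?_⟩
    have : n • cls I u • x ∈ radSpan (PathAlgebra k V ⧸ I) (cls I u • x) := ⟨n, hn, rfl⟩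
    rw [radSpan_mast_smul hI hlen hpx, Submodule.mem_bot] at this
    rw [this, zero_smul]
  | succ l ih =>
    intro c u r h hr n hn
    obtain ⟨d, α, r', hr', rfl⟩ := Path.eq_toPath_comp_of_length_eq_succ r hr
    rw [← Path.comp_assoc, Path.comp_toPath_eq_cons] at h
    have : n • cls I u • x ∈ radSpan (PathAlgebra k V ⧸ I) (cls I u • x) := ⟨n, hn, rfl⟩
    rw [radSpan_cls_smul hI hlen hpx h] at this
    obtain ⟨a, ha⟩ := Submodule.mem_span_singleton.1 this
    obtain ⟨s, m, hm, hs⟩ := exists_smul_add_mem_jacobson hI a (u.cons α)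
    obtain ⟨t, ht, htx⟩ := ih h hr' m hm
    refine ⟨s • cls I (u.cons α) + t, add_mem (Submodule.smul_mem _ _ (Submodule.subset_span
      ⟨d, u.cons α, ⟨r', h⟩, by simp, rfl⟩)) (subpathSpanAll_mono (by simp) ht), ?_⟩
    rw [← ha, smul_smul, hs, add_smul, add_smul, ← htx, mul_smul]

include hI hlen hpx in
theorem arrow_smul_mem_subpathSpan {c d : V} {u : Path e c} (hu : IsRightSubpath u p)
    (α : c ⟶ d) :
    ∃ t ∈ subpathSpan I p (u.length + 1) d, cls I (u.cons α) • x = t • x := by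
  obtain ⟨r, hr⟩ := hu
  obtain ⟨t, ht, h⟩ := jacobson_smul_mem_subpathSpanAll hI hlen hpx hr rfl (cls I α.toPath)
    (mem_jacobson_of_mem_longCls hI (cls_mem_longCls _ (by simp)))
  -- Multiplication by the trivial path at `d` fixes `α u x` and discards the subpaths ending
  -- elsewhere.
  refine ⟨_, nil_mul_mem_subpathSpan ht d, ?_⟩
  rw [mul_smul, ← h, ← cls_cons_smul, smul_smul, cls_mul_cls, Path.comp_nil]

end Length

end Mast
-- Vertex sequences of right subpaths
section Routes

variable {V : Type v} [Quiver.{w} V] {e f : V} {p : Path e f}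

/-- Last arrows are cancelled on both sides until `s'` is used up; what is then left of `s` is the
required `r`. -/
theorem exists_comp_of_comp_eq_comp {c d : V} {v : Path e c} {v' : Path e d} {s : Path c f}
    {s' : Path d f} (h : v.comp s = v'.comp s') (hl : v.length ≤ v'.length) :
    ∃ r : Path c d, v.comp r = v' := by
  induction s' with
  | nil => exact ⟨s, h⟩
  | cons s' β ih =>
    cases s with
    | nil =>
      have := congrArg Path.length h
      simp only [Path.comp_nil, Path.length_comp, Path.length_cons] at this
      omega
    | cons s α =>
      simp only [Path.comp_cons, Path.cons.injEq] at h
      obtain ⟨rfl, h, -⟩ := h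
      exact ih (eq_of_heq h)

theorem IsRightSubpath.exists_comp_of_length_le {c d : V} {v : Path e c} {v' : Path e d}
    (hv : IsRightSubpath v p) (hv' : IsRightSubpath v' p) (h : v.length ≤ v'.length) :
    ∃ r : Path c d, v.comp r = v' := by
  obtain ⟨s, hs⟩ := hv
  obtain ⟨s', hs'⟩ := hv'
  exact exists_comp_of_comp_eq_comp (hs.trans hs'.symm) h

theorem IsRightSubpath.vertices_sublist {c : V} {v : Path e c} (hv : IsRightSubpath v p) :
    v.vertices.Sublist p.vertices := by
  obtain ⟨r, rfl⟩ := hv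
  induction r with
  | nil => exact List.Sublist.refl _
  | cons r α ih =>
    rw [Path.comp_cons, Path.vertices_cons, List.concat_eq_append]
    exact ih.trans (List.sublist_append_left _ _)

theorem IsRightSubpath.concat_vertices_sublist {c d : V} {v : Path e c} {v' : Path e d}
    (hv : IsRightSubpath v p) (hv' : IsRightSubpath v' p) (h : v.length < v'.length)
    {l : List V} (hl : l.Sublist v.vertices) : (l ++ [d]).Sublist v'.vertices := by
  obtain ⟨r, rfl⟩ := hv.exists_comp_of_length_le hv' h.le
  cases r with
  | nil => simp at h
  | cons r α =>
    rw [Path.comp_cons, Path.vertices_cons, List.concat_eq_append]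
    exact (hl.trans (IsRightSubpath.vertices_sublist ⟨r, rfl⟩)).append (List.Sublist.refl _)

theorem not_isRoute_of_length_lt {q : QPath V} (h : p.length < q.path.length) : ¬ IsRoute p q := by
  rintro ⟨-, hs⟩
  have := hs.length_le
  rw [Path.vertices_length, Path.vertices_length] at this
  omega

end Routes

/-! ### The annihilator of the generator in `Λe` -/

section Main

variable {k : Type u} {V : Type v} [Field k] [Quiver.{w} V] [Fintype V]
  {I : Ideal (PathAlgebra k V)} [I.IsTwoSided]

section Annihilator

variable {U : Type*} [AddCommGroup U] [Module (PathAlgebra k V ⧸ I) U]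
  {e f : V} {p : Path e f} {x : U}
  (hI : IsAdmissible I)
  (hlen : Module.length (PathAlgebra k V ⧸ I) U = ((p.length + 1 : ℕ) : ℕ∞))
  (hpx : cls I p • x ≠ 0)

include hI hlen hpx in
-- An arrow replaces each `v` by strictly longer right subpaths ending at the new vertex, so that
-- vertex is met after all those of `v` and the sublist relation survives.
theorem path_smul_mem_span {d : V} (q : Path e d) :
    ∃ t ∈ Submodule.span k {y : PathAlgebra k V ⧸ I | ∃ v : Path e d, IsRightSubpath v p ∧
      q.vertices.Sublist v.vertices ∧ y = cls I v}, cls I q • x = t • x := by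
  induction q with
  | nil => exact ⟨_, Submodule.subset_span ⟨Path.nil, ⟨p, Path.nil_comp p⟩, .refl _, rfl⟩, rfl⟩
  | @cons b c q α ih =>
    obtain ⟨t, ht, h⟩ := ih
    rw [cls_cons_smul, h]
    clear h
    refine Submodule.span_induction (p := fun t _ => ∃ t' ∈ Submodule.span k
      {y : PathAlgebra k V ⧸ I | ∃ v : Path e c, IsRightSubpath v p ∧
      (q.cons α).vertices.Sublist v.vertices ∧ y = cls I v},
      cls I α.toPath • t • x = t' • x) ?_ ?_ ?_ ?_ ht
    · rintro _ ⟨v, hv, hs, rfl⟩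
      obtain ⟨t, ht, h⟩ := arrow_smul_mem_subpathSpan hI hlen hpx hv α
      refine ⟨t, Submodule.span_mono ?_ ht, by rw [← cls_cons_smul, h]⟩
      rintro _ ⟨v', hv', hl, rfl⟩
      refine ⟨v', hv', ?_, rfl⟩
      rw [Path.vertices_cons, List.concat_eq_append]
      exact hv.concat_vertices_sublist hv' hl hs
    · exact ⟨0, zero_mem _, by simp⟩
    · rintro a b - - ⟨a', ha', ha⟩ ⟨b', hb', hb⟩
      exact ⟨a' + b', add_mem ha' hb', by rw [add_smul, add_smul, smul_add, ha, hb]⟩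
    · rintro s a - ⟨a', ha', ha⟩
      refine ⟨s • a', Submodule.smul_mem _ _ ha', ?_⟩
      rw [smul_smul, mul_smul_comm, Algebra.smul_def, mul_smul, mul_smul, ha, Algebra.smul_def,
        mul_smul]

include hI hlen hpx in
theorem path_smul_eq_zero_of_not_isRoute {d : V} {q : Path e d} (hq : ¬ IsRoute p ⟨e, d, q⟩) :
    cls I q • x = 0 := by
  obtain ⟨t, ht, h⟩ := path_smul_mem_span hI hlen hpx q
  rw [h]
  have : t ∈ (⊥ : Submodule k (PathAlgebra k V ⧸ I)) := by
    refine Submodule.span_le.2 ?_ ht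
    rintro _ ⟨v, hv, hs, rfl⟩
    exact absurd ⟨rfl, hs.trans hv.vertices_sublist⟩ hq
  rw [(Submodule.mem_bot k).1 this, zero_smul]

theorem mem_leftProj {e : V} {a : PathAlgebra k V ⧸ I} :
    a ∈ leftProj I e ↔ a * cls I (Path.nil : Path e e) = a := by
  refine ⟨fun h => ?_, fun h => Submodule.mem_span_singleton.2 ⟨a, h⟩⟩
  obtain ⟨b, rfl⟩ := Submodule.mem_span_singleton.1 h
  rw [smul_eq_mul, mul_assoc, cls_mul_cls, Path.nil_comp]

theorem cls_mem_leftProj {e f : V} (p : Path e f) : cls I p ∈ leftProj I e :=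
  mem_leftProj.2 (by rw [cls_mul_cls, Path.nil_comp])

instance (e : V) : Module.Projective (PathAlgebra k V ⧸ I) (leftProj I e) := by
  refine Module.Projective.of_split (leftProj I e).subtype
    ((LinearMap.toSpanSingleton _ _ (cls I (Path.nil : Path e e))).codRestrict _ fun a =>
      Submodule.mem_span_singleton.2 ⟨a, rfl⟩) ?_
  ext a
  exact mem_leftProj.1 a.2

include hI in
-- A nonzero scalar part of `a u` would put `u x` into `J u x`, against Nakayama. With `u` trivial
-- this shows that the kernel of `Λe → U` is superfluous; with `u = p` it sharpens `Λp` to `Jp`.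
theorem exists_mem_jacobson_mul_of_smul_eq_zero {c : V} {u : Path e c} (hu : cls I u • x ≠ 0)
    {a : PathAlgebra k V ⧸ I} (h : (a * cls I u) • x ∈ radSpan (PathAlgebra k V ⧸ I) (cls I u • x)) :
    ∃ n ∈ Ring.jacobson (PathAlgebra k V ⧸ I), a * cls I u = n * cls I u := by
  obtain ⟨t, n, hn, ha⟩ := exists_smul_add_mem_jacobson hI a u
  by_cases ht : t = 0
  · exact ⟨n, hn, by rw [ha, ht, zero_smul, zero_add]⟩
  · refine absurd ?_ (notMem_radSpan_self (R := PathAlgebra k V ⧸ I) hu)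
    have h1 : (n * cls I u) • x ∈ radSpan (PathAlgebra k V ⧸ I) (cls I u • x) :=
      ⟨n, hn, (mul_smul _ _ _).symm⟩
    have h2 := Submodule.smul_mem _ (algebraMap k (PathAlgebra k V ⧸ I) t⁻¹) (sub_mem h h1)
    rwa [← sub_smul, ha, add_sub_cancel_right, smul_smul, ← Algebra.smul_def,
      inv_smul_smul₀ ht] at h2

include hI hlen hpx in
/-- `p` does not start with a cycle, hence `e · JU = 0`. -/
theorem eq_zero_of_mem_radical (hcyc : ¬ StartsWithCycle p) {y : U}
    (hy : y ∈ radSpan (PathAlgebra k V ⧸ I) (cls I (Path.nil : Path e e) • x))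
    (hey : cls I (Path.nil : Path e e) • y = y) : y = 0 := by
  obtain ⟨n, hn, rfl⟩ := hy
  change n • cls I (Path.nil : Path e e) • x = 0
  change _ • n • cls I (Path.nil : Path e e) • x = n • cls I (Path.nil : Path e e) • x at hey
  obtain ⟨t, ht, h⟩ := jacobson_smul_mem_subpathSpanAll hI hlen hpx (Path.nil_comp p) rfl n hn
  have h0 := nil_mul_mem_subpathSpan ht e
  have : cls I (Path.nil : Path e e) * t ∈ (⊥ : Submodule k (PathAlgebra k V ⧸ I)) := by
    refine Submodule.span_le.2 ?_ h0
    rintro _ ⟨v, hv, hl, rfl⟩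
    exact absurd ⟨v, by simp only [Path.length_nil] at hl; omega, hv⟩ hcyc
  rw [h, smul_smul, (Submodule.mem_bot k).1 this, zero_smul] at hey
  rw [h, ← hey]

end Annihilator

variable (I) in
/-- The map `Λe → U` sending `e` to `e x`. -/
noncomputable def leftProjMap (e : V) {U : Type*} [AddCommGroup U]
    [Module (PathAlgebra k V ⧸ I) U] (x : U) : leftProj I e →ₗ[PathAlgebra k V ⧸ I] U :=
  LinearMap.toSpanSingleton _ U x ∘ₗ (leftProj I e).subtype

theorem leftProjMap_apply {e : V} {U : Type*} [AddCommGroup U]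
    [Module (PathAlgebra k V ⧸ I) U] (x : U) (a : leftProj I e) :
    leftProjMap I e x a = (a : PathAlgebra k V ⧸ I) • x := rfl

variable {U : Type (max u v w)} [AddCommGroup U] [Module (PathAlgebra k V ⧸ I) U]
  {e f : V} {p : Path e f} {x : U}

theorem leftProjMap_surjective (hI : IsAdmissible I)
    (hlen : Module.length (PathAlgebra k V ⧸ I) U = ((p.length + 1 : ℕ) : ℕ∞))
    (hpx : cls I p • x ≠ 0) : Function.Surjective (leftProjMap I e x) := by
  intro y
  have hy : y ∈ Submodule.span _ {cls I (Path.nil : Path e e) • x} :=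
    span_eq_top_of_mast hI hlen hpx ▸ Submodule.mem_top
  obtain ⟨a, rfl⟩ := Submodule.mem_span_singleton.1 hy
  exact ⟨⟨a • cls I (Path.nil : Path e e), Submodule.mem_span_singleton.2 ⟨a, rfl⟩⟩,
    mul_smul _ _ _⟩

/-- The kernel of `Λe → U` is `Jp`. -/
theorem ker_leftProjMap [∀ a b : V, Finite (a ⟶ b)] (hI : IsAdmissible I)
    (hlen : Module.length (PathAlgebra k V ⧸ I) U = ((p.length + 1 : ℕ) : ℕ∞))
    (hpx : cls I p • x ≠ 0) (hpos : 0 < p.length) (hcyc : ¬ StartsWithCycle p)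
    (hirr : IsIrreducibleMap (radical (PathAlgebra k V ⧸ I) U).subtype) :
    LinearMap.ker (leftProjMap I e x) = (radMulPath I p).submoduleOf (leftProj I e) := by
  have := finite_quotient hI
  have : IsNoetherian (PathAlgebra k V ⧸ I) (PathAlgebra k V ⧸ I) := isNoetherian_of_tower k
    inferInstance
  have : IsArtinian (PathAlgebra k V ⧸ I) (PathAlgebra k V ⧸ I) := isArtinian_of_tower k
    inferInstance
  have hex : cls I (Path.nil : Path e e) • x ≠ 0 := cls_smul_ne_zero_of_comp (Path.nil_comp p) hpx
  have hrad := radical_eq_radSpan (span_eq_top_of_mast hI hlen hpx)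
  have hpJ : cls I p ∈ Ring.jacobson (PathAlgebra k V ⧸ I) :=
    mem_jacobson_of_mem_longCls hI (cls_mem_longCls p hpos)
  have key : LinearMap.ker (leftProjMap I e x) ≤
      (Submodule.span (PathAlgebra k V ⧸ I) {cls I p}).submoduleOf (leftProj I e) := by
    refine ker_le_of_isIrreducibleMap (leftProjMap_surjective hI hlen hpx) ?_ hirr ?_ ?_ ?_
    · rintro ⟨a, ha⟩ hax
      have hae := mem_leftProj.1 ha
      have h0 : a • x = 0 := hax
      obtain ⟨n, hn, h⟩ := exists_mem_jacobson_mul_of_smul_eq_zero hI hex (a := a)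
        (by rw [hae, h0]; exact zero_mem _)
      refine Ring.jacobson_smul_top_le _ _ ?_
      have : (⟨a, ha⟩ : leftProj I e) = n • ⟨_, cls_mem_leftProj Path.nil⟩ :=
        Subtype.ext (hae.symm.trans h)
      rw [this]
      exact Submodule.smul_mem_smul hn Submodule.mem_top
    -- A map out of `Λe` is determined by the image of `e`, which here lies in `e·JU = 0`.
    · intro φ
      have h0 : φ ⟨_, cls_mem_leftProj Path.nil⟩ = 0 := by
        refine Subtype.ext (eq_zero_of_mem_radical hI hlen hpx hcyc (hrad ▸ Subtype.property _) ?_)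
        rw [← Submodule.coe_smul, ← map_smul]
        congr 2
        exact Subtype.ext (mem_leftProj.1 (cls_mem_leftProj Path.nil))
      ext a
      have : a = (a : PathAlgebra k V ⧸ I) • ⟨_, cls_mem_leftProj Path.nil⟩ :=
        Subtype.ext (mem_leftProj.1 a.2).symm
      rw [this, map_smul, h0, smul_zero, LinearMap.zero_apply]
    · rintro a ha
      obtain ⟨b, hb⟩ := Submodule.mem_span_singleton.1 (show (a : PathAlgebra k V ⧸ I) ∈ _ from ha)
      rw [Submodule.mem_comap, leftProjMap_apply, ← hb]
      exact Submodule.smul_mem_smul (Ideal.mul_mem_left _ _ hpJ) Submodule.mem_top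
    · intro h
      exact hpx (h (show (⟨_, cls_mem_leftProj p⟩ : leftProj I e) ∈ _ from
        Submodule.mem_span_singleton_self _))
  ext ⟨a, ha⟩
  constructor
  · intro h
    obtain ⟨b, hb⟩ := Submodule.mem_span_singleton.1 (show a ∈ _ from key h)
    have hax : a • x = 0 := h
    obtain ⟨n, hn, h⟩ := exists_mem_jacobson_mul_of_smul_eq_zero hI hpx (a := b)
      (by rw [show b * cls I p = a from hb, hax]; exact zero_mem _)
    exact ⟨n, hn, h.symm.trans hb⟩
  · rintro ⟨n, hn, h⟩
    have : n • cls I p • x ∈ radSpan (PathAlgebra k V ⧸ I) (cls I p • x) := ⟨n, hn, rfl⟩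
    rw [radSpan_mast_smul hI hlen hpx, Submodule.mem_bot, smul_smul] at this
    change a • x = 0
    rw [← this]
    exact congrArg (· • x) h.symm

/-- The elements of `Jp` are linear combinations of paths which are not routes on `p`. -/
theorem mem_span_of_mem_radMulPath (hI : IsAdmissible I) {a : PathAlgebra k V ⧸ I}
    (ha : a ∈ radMulPath I p) : a ∈ Submodule.span k {x : PathAlgebra k V ⧸ I |
      ∃ q : QPath V, ¬ IsRoute p q ∧ x = cls I q.path} := by
  obtain ⟨n, hn, rfl⟩ := ha
  -- The radical is spanned by paths of positive length, so `n p` is a combination of paths longer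
  -- than `p`; these have too many vertices to be routes.
  have hm := mul_mem_longCls ((mem_jacobson_iff_mem_longCls hI).1 hn)
    (cls_mem_longCls (I := I) p le_rfl)
  refine Submodule.span_mono ?_ hm
  rintro _ ⟨q, hq, rfl⟩
  exact ⟨q, not_isRoute_of_length_lt (by omega), rfl⟩

end Main
end QuiverAlgebra

/-! ### Detours, non-routes and the presentation of `U` -/

theorem mainTheorem4 {k : Type u} {V : Type v} [Field k] [Quiver.{w} V] [Fintype V]
    [∀ a b : V, Finite (a ⟶ b)]
    (I : Ideal (PathAlgebra k V)) [I.IsTwoSided]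
    (hI : IsAdmissible I)
    (U : Type (max u v w)) [AddCommGroup U] [Module (PathAlgebra k V ⧸ I) U]
    [Module.Finite (PathAlgebra k V ⧸ I) U]
    (hU : IsUniserial (PathAlgebra k V ⧸ I) U)
    (hns : ¬ IsSimpleModule (PathAlgebra k V ⧸ I) U)
    {e f : V} (p : Quiver.Path e f) (hp : IsMast I p U)
    (hcyc : ¬ StartsWithCycle p)
    (hirr : IsIrreducibleMap
      (radical (PathAlgebra k V ⧸ I) U).subtype) :
    (∀ {c d : V} (α : c ⟶ d) (u : Quiver.Path e c),
      IsDetour p α u → IsInessential I p α u) ∧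
    (∀ q : QPath V, IsNonRoute p q →
      cls I q.path ∈ radMulPath I p) ∧
    Nonempty (U ≃ₗ[PathAlgebra k V ⧸ I]
      (leftProj I e ⧸
        (radMulPath I p).submoduleOf (leftProj I e))) := by
  -- `hU` is not needed: a module of length `p.length + 1` with mast `p` is uniserial.
  obtain ⟨hlen, x, hpx⟩ := hp
  have hpos : 0 < p.length := by
    refine Nat.pos_of_ne_zero fun h0 => hns (Module.length_eq_one_iff.1 ?_)
    rw [hlen, h0]
    rfl
  have hker := ker_leftProjMap hI hlen hpx hpos hcyc hirr
  have hann {a : PathAlgebra k V ⧸ I} (ha : a ∈ leftProj I e) (hax : a • x = 0) :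
      a ∈ radMulPath I p := by
    have : (⟨a, ha⟩ : leftProj I e) ∈ LinearMap.ker (leftProjMap I e x) := hax
    rw [hker] at this
    exact this
  refine ⟨fun {c d} α u hd => ?_, ?_, ⟨((Submodule.quotEquivOfEq _ _ hker).symm.trans
    ((leftProjMap I e x).quotKerEquivOfSurjective
      (leftProjMap_surjective hI hlen hpx))).symm⟩⟩
  · obtain ⟨t, ht, h⟩ := arrow_smul_mem_subpathSpan hI hlen hpx hd.1 α
    have htP : t ∈ leftProj I e := by
      have : subpathSpan I p (u.length + 1) d ≤ (leftProj I e).restrictScalars k := by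
        refine Submodule.span_le.2 ?_
        rintro _ ⟨v, -, -, rfl⟩
        exact cls_mem_leftProj v
      exact this ht
    -- The difference `α u - t` kills `x`, so it lies in `Jp` and supplies the part without routes.
    refine ⟨cls I (u.cons α) - t, mem_span_of_mem_radMulPath hI (hann
      (sub_mem (cls_mem_leftProj _) htP) (by rw [sub_smul, h, sub_self])), t, ht, by abel⟩
  · rintro ⟨a, b, q⟩ ⟨rfl, hq⟩
    exact hann (cls_mem_leftProj q) (path_smul_eq_zero_of_not_isRoute hI hlen hpx hq)
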